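/- Let $\mathbb N$ denote the positive integers. An invertible dynamical system $(X,T)$ is a compact metric space $(X,\rho)$ with a homeomorphism $T\colon X\to X$. It is minimal if $X$ is the only non-empty closed $K\subset X$ with $T(K)\subset K$, and totally minimal if $(X,T^n)$ is minimal for every $n\in\mathbb N$. A point is minimal if it lies in a non-empty closed set $K$ with $T(K)\subset K$ that contains no smaller non-empty closed set $L$ with $T(L)\subset L$. Points $x,y$ are proximal if $\inf_{n\in\mathbb Z}\rho(T^nx,T^ny)=0$. The system is proximal orbit dense (POD) if it is totally minimal and whenever $x\neq y$ there is $n\in\mathbb Z$, $n\ne 0$, such that $T^ny$ is proximal to $x$. For $r,s\in\mathbb N$ put $$\mathrm{Prox}(T^r,T^s)=\Bigl\{(x,y)\in X^2:\ \liminf_{n\to\infty}\rho(T^{rn}x,T^{sn}y)=0\Bigr\}.$$ **Proposition.** (1) If $(X,T)$ is a POD system, then $\mathrm{Prox}(T^r,T^s)=X^2$ for all $r,s\in\mathbb N$ with $r\neq s$. (2) If a POD system $(X,T)$ is non-trivial (that is, $X$ has at least two points), then it has more than one minimal point. (3) There is a POD system $(X,T)$ with more than one minimal point and with $\mathrm{Prox}(T^r,T^s)=X^2$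 for all distinct $r,s\in\mathbb N$. Consequently Moothathu's question, whether $T$ has only one minimal point as soon as $\mathrm{Prox}(T^r,T^s)=X^2$ for some $r,s\in\mathbb N$, has a negative answer. -/

import Mathlib

open Filter Set Topology

/-- `(X, T)` is minimal: it has no proper subsystem, i.e. the only non-empty closed subset `K`
with `T(K) ⊆ K` is `X` itself. -/
def IsMinimalMap {X : Type*} [TopologicalSpace X] (T : X → X) : Prop :=
  ∀ K : Set X, IsClosed K → K.Nonempty → MapsTo T K K → K = univ

/-- `(X, T)` is totally minimal: `(X, T^n)` is minimal for every positive integer `n`. -/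
def IsTotallyMinimal {X : Type*} [TopologicalSpace X] (T : X → X) : Prop :=
  ∀ n : ℕ, 0 < n → IsMinimalMap (T^[n])

/-- `x` is a minimal point of `(X, T)`: it lies in a subsystem `K` that has no proper subsystem. -/
def IsMinimalPoint {X : Type*} [TopologicalSpace X] (T : X → X) (x : X) : Prop :=
  ∃ K : Set X, IsClosed K ∧ MapsTo T K K ∧ x ∈ K ∧
    ∀ L : Set X, IsClosed L → L.Nonempty → MapsTo T L L → L ⊆ K → L = K

/-- The relation `Prox(T^r, T^s)`: the pairs `(x, y)` with
`liminf_{n → ∞} ρ(T^{rn} x, T^{sn} y) = 0`. -/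
def Prox {X : Type*} [MetricSpace X] (T : X → X) (r s : ℕ) : Set (X × X) :=
  {p | liminf (fun n : ℕ => dist (T^[r * n] p.1) (T^[s * n] p.2)) atTop = 0}

/-- `x` and `y` are proximal for the invertible system `(X, T)`, that is, for the action of `ℤ`
by the powers of `T`: `inf_{n ∈ ℤ} ρ(T^n x, T^n y) = 0`. -/
def IsProximalPair {X : Type*} [MetricSpace X] (T : X ≃ₜ X) (x y : X) : Prop :=
  ∀ ε : ℝ, 0 < ε → ∃ n : ℤ, dist ((T ^ n) x) ((T ^ n) y) < ε

/-- The invertible system `(X, T)` is proximal orbit dense (POD). -/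
def IsPOD {X : Type*} [MetricSpace X] (T : X ≃ₜ X) : Prop :=
  IsTotallyMinimal (T : X → X) ∧
    ∀ x y : X, x ≠ y → ∃ n : ℤ, n ≠ 0 ∧ IsProximalPair T ((T ^ n) y) x

/-! For (1), every closed non-empty set invariant under `T^r × T^s` must meet the diagonal; applied
to closures of orbit tails, this gives liminf zero (`IsPOD.prox_eq_univ`). By Zorn it suffices to
treat a minimal such set `M`. Consider the group of `(i, j) ∈ ℤ²` for which `T^i × T^j` preserves
`M`. It contains `(r, s)`. As `M` projects onto `X`, it contains some `(x, y)` and `(T x, y')`;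
either `y' = y`, or some `T^n y` is proximal to `y'`, and then `M` and its image under `T × T^n`
have distance zero, so they coincide. Hence some `(1, n)` lies in the group, and so does `(0, s - r
n)`. If `s ≠ r n`, total minimality makes a vertical fibre of `M` all of `X`. Otherwise `r ∣ s`;
exchanging coordinates gives `s ∣ r`, impossible for `r ≠ s`.

(2) is immediate, since in a minimal system every point is minimal.

For (3), a non-trivial POD system is built as a rank-one subshift with blocks `B_{k+1} = B_k^N (1
B_k)^h`, where `h` is the length of `B_k` and `1` is a spacer. The spacers realise every residue
modulo `m`, whence total minimality (`exists_mul_shift_agree`). For POD, let `A k` be the set of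
offsets between occurrences of `B_k` in `x` and in `y ≠ x`. A non-zero offset common to all `A k`
aligns arbitrarily long blocks, and `IsOffsetFamily.exists_common` produces one: otherwise intervals
in the `A k` could be lengthened without bound, forcing `1` or `-1` into a set that excludes both.
-/

theorem exists_minimal_closed_mapsTo {Y : Type*} [TopologicalSpace Y] [CompactSpace Y] (f : Y → Y)
    {K : Set Y} (hK : IsClosed K) (hne : K.Nonempty) (hf : MapsTo f K K) :
    ∃ M ⊆ K, IsClosed M ∧ M.Nonempty ∧ MapsTo f M M ∧
      ∀ L : Set Y, IsClosed L → L.Nonempty → MapsTo f L L → L ⊆ M → L = M := by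
  obtain ⟨M, hMK, hM⟩ := zorn_superset_nonempty
    {L : Set Y | IsClosed L ∧ L.Nonempty ∧ MapsTo f L L} (by
      intro c hc hchain hcne
      refine ⟨⋂₀ c, ⟨isClosed_sInter fun s hs => (hc hs).1, ?_, ?_⟩,
        fun s hs => sInter_subset_of_mem hs⟩
      · have := hcne.to_subtype
        refine IsCompact.nonempty_sInter_of_directed_nonempty_isCompact_isClosed ?_
          (fun s hs => (hc hs).2.1) (fun s hs => (hc hs).1.isCompact) (fun s hs => (hc hs).1)
        exact IsChain.directedOn (r := fun s t : Set Y => s ⊇ t) hchain.symm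
      · intro x hx s hs
        exact (hc hs).2.2 (hx s hs)) K ⟨hK, hne, hf⟩
  exact ⟨M, hMK, hM.1.1, hM.1.2.1, hM.1.2.2, fun L h1 h2 h3 h4 =>
    hM.eq_of_subset ⟨h1, h2, h3⟩ h4⟩

theorem coe_homeomorph_pow {X : Type*} [TopologicalSpace X] (T : X ≃ₜ X) (n : ℕ) :
    ⇑(T ^ n) = T^[n] := by
  induction n with
  | zero => rfl
  | succ n ih => rw [pow_succ, Function.iterate_succ, ← ih]; rfl

theorem homeomorph_zpow_add_apply {X : Type*} [TopologicalSpace X] (T : X ≃ₜ X) (i j : ℤ) (x : X) :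
    (T ^ (i + j)) x = (T ^ i) ((T ^ j) x) := by
  rw [zpow_add]; rfl

/-! ### Stabilizers of minimal sets in the product, and parts (1) and (2). -/

section Stabilizer

variable {X : Type*} [MetricSpace X]

/-- The set `M` is preserved by `T ^ i × T ^ j`. -/
def Stabilizes (T : X ≃ₜ X) (M : Set (X × X)) (i j : ℤ) : Prop :=
  ∀ p : X × X, p ∈ M ↔ ((T ^ i) p.1, (T ^ j) p.2) ∈ M

variable {T : X ≃ₜ X} {M : Set (X × X)}

theorem Stabilizes.zero : Stabilizes T M 0 0 := fun p => by simp

theorem Stabilizes.add {i j k l : ℤ} (h : Stabilizes T M i j) (h' : Stabilizes T M k l) :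
    Stabilizes T M (i + k) (j + l) := fun p => by
  rw [h' p, h _, homeomorph_zpow_add_apply, homeomorph_zpow_add_apply]

theorem Stabilizes.neg {i j : ℤ} (h : Stabilizes T M i j) : Stabilizes T M (-i) (-j) := fun p => by
  rw [h ((T ^ (-i)) p.1, (T ^ (-j)) p.2)]
  simp only [← homeomorph_zpow_add_apply]
  simp

theorem Stabilizes.nsmul {i j : ℤ} (h : Stabilizes T M i j) (n : ℕ) :
    Stabilizes T M (n * i) (n * j) := by
  induction n with
  | zero => simpa using Stabilizes.zero
  | succ n ih =>
    have := ih.add h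
    simpa [add_mul] using this

theorem Stabilizes.zsmul {i j : ℤ} (h : Stabilizes T M i j) (n : ℤ) :
    Stabilizes T M (n * i) (n * j) := by
  obtain ⟨m, rfl | rfl⟩ := n.eq_nat_or_neg
  · exact h.nsmul m
  · simpa using (h.nsmul m).neg

/-- `T^i × T^j` commutes with `T^r × T^s`, so the image of `M` is again closed and invariant;
minimality turns inclusion into equality. -/
theorem stabilizes_of_forward [CompactSpace X] {r s : ℤ} (hM : IsClosed M) (hne : M.Nonempty)
    (hrs : ∀ p ∈ M, ((T ^ r) p.1, (T ^ s) p.2) ∈ M)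
    (hmin : ∀ L : Set (X × X), IsClosed L → L.Nonempty →
      (∀ p ∈ L, ((T ^ r) p.1, (T ^ s) p.2) ∈ L) → L ⊆ M → L = M)
    {i j : ℤ} (hij : ∀ p ∈ M, ((T ^ i) p.1, (T ^ j) p.2) ∈ M) : Stabilizes T M i j := by
  intro p
  refine ⟨hij p, fun hp => ?_⟩
  let e : X × X ≃ₜ X × X := (T ^ i).prodCongr (T ^ j)
  have he : ∀ q, e q = ((T ^ i) q.1, (T ^ j) q.2) := fun _ => rfl
  have heq : e '' M = M := by
    refine hmin _ ((e.isClosed_image).2 hM) (hne.image _) ?_ ?_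
    · rintro _ ⟨q, hq, rfl⟩
      refine ⟨_, hrs q hq, ?_⟩
      simp only [he, ← homeomorph_zpow_add_apply]
      rw [add_comm i, add_comm j]
    · rintro _ ⟨q, hq, rfl⟩
      exact hij q hq
  have hp' : e p ∈ e '' M := by rw [heq]; exact hp
  exact (e.injective.mem_set_image).1 hp'

/-- One returning point is enough: the points of `M` that `T^i × T^j` sends into `M` form a closed
invariant subset. -/
theorem stabilizes_of_mem [CompactSpace X] {r s : ℤ} (hM : IsClosed M)
    (hrs : ∀ p ∈ M, ((T ^ r) p.1, (T ^ s) p.2) ∈ M)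
    (hmin : ∀ L : Set (X × X), IsClosed L → L.Nonempty →
      (∀ p ∈ L, ((T ^ r) p.1, (T ^ s) p.2) ∈ L) → L ⊆ M → L = M)
    {i j : ℤ} {p : X × X} (hp : p ∈ M) (hp' : ((T ^ i) p.1, (T ^ j) p.2) ∈ M) :
    Stabilizes T M i j := by
  refine stabilizes_of_forward hM ⟨p, hp⟩ hrs hmin ?_
  have hc : Continuous fun q : X × X => ((T ^ i) q.1, (T ^ j) q.2) :=
    ((T ^ i).prodCongr (T ^ j)).continuous
  have heq : M ∩ (fun q : X × X => ((T ^ i) q.1, (T ^ j) q.2)) ⁻¹' M = M := by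
    refine hmin _ (hM.inter (hM.preimage hc)) ⟨p, hp, hp'⟩ ?_ inter_subset_left
    rintro q ⟨hq, hq'⟩
    refine ⟨hrs q hq, ?_⟩
    have := hrs _ hq'
    simp only [mem_preimage, ← homeomorph_zpow_add_apply] at this ⊢
    rwa [add_comm i, add_comm j]
  intro q hq
  rw [← heq] at hq
  exact hq.2

/-- Proximality along `ℤ` implies proximality along the multiples of a positive integer. -/
theorem IsProximalPair.exists_mul [CompactSpace X] {x y : X} (h : IsProximalPair T x y) {s : ℕ}
    (hs : 0 < s) {ε : ℝ} (hε : 0 < ε) :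
    ∃ m : ℤ, dist ((T ^ (s * m : ℤ)) x) ((T ^ (s * m : ℤ)) y) < ε := by
  -- Rounding a time down to a multiple of `s` applies one of the finitely many uniformly continuous
  -- maps `T^(-i)`, `i < s`.
  have huc : ∀ i : ℕ, ∃ δ > 0, ∀ a b : X, dist a b < δ →
      dist ((T ^ (-(i : ℤ))) a) ((T ^ (-(i : ℤ))) b) < ε := by
    intro i
    have := CompactSpace.uniformContinuous_of_continuous (T ^ (-(i : ℤ))).continuous
    obtain ⟨δ, hδ, H⟩ := Metric.uniformContinuous_iff.1 this ε hε
    exact ⟨δ, hδ, fun a b hab => H hab⟩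
  choose δ hδ H using huc
  have hne : (Finset.range s).Nonempty := ⟨0, Finset.mem_range.2 hs⟩
  obtain ⟨n, hn⟩ := h ((Finset.range s).inf' hne δ)
    ((Finset.lt_inf'_iff hne).2 fun i _ => hδ i)
  have hs' : (0 : ℤ) < s := by exact_mod_cast hs
  have hnn := Int.emod_nonneg n hs'.ne'
  have hlt := Int.emod_lt_of_pos n hs'
  have hi : ((n % s).toNat : ℤ) = n % s := Int.toNat_of_nonneg hnn
  have := H (n % s).toNat _ _ (lt_of_lt_of_le hn (Finset.inf'_le _
    (Finset.mem_range.2 (by omega))))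
  refine ⟨n / s, ?_⟩
  have e : (s : ℤ) * (n / s) = -((n % s).toNat : ℤ) + n := by
    rw [hi]; have := Int.emod_add_mul_ediv n s; linarith
  rwa [e, homeomorph_zpow_add_apply, homeomorph_zpow_add_apply]

/-- Moving both points along `(m r, m s)` keeps them in `M`. Their first coordinates match after
`T^i`, and proximality along multiples of `s` brings the second ones together. Disjoint compact sets
cannot come this close. -/
theorem stabilizes_of_proximal [CompactSpace X] {r s : ℕ} (hs : 0 < s) (hM : IsClosed M)
    (hrs : ∀ p ∈ M, ((T ^ (r : ℤ)) p.1, (T ^ (s : ℤ)) p.2) ∈ M)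
    (hmin : ∀ L : Set (X × X), IsClosed L → L.Nonempty →
      (∀ p ∈ L, ((T ^ (r : ℤ)) p.1, (T ^ (s : ℤ)) p.2) ∈ L) → L ⊆ M → L = M)
    {i j : ℤ} {p : X × X} {y : X} (hp : p ∈ M) (hy : ((T ^ i) p.1, y) ∈ M)
    (hprox : IsProximalPair T ((T ^ j) p.2) y) :
    Stabilizes T M i j := by
  have hst : Stabilizes T M r s := stabilizes_of_forward hM ⟨p, hp⟩ hrs hmin hrs
  let e : X × X ≃ₜ X × X := (T ^ i).prodCongr (T ^ j)
  have he : ∀ q, e q = ((T ^ i) q.1, (T ^ j) q.2) := fun _ => rfl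
  have hclosed : IsClosed (e '' M) := (e.isClosed_image).2 hM
  have hnd : ¬ Disjoint (e '' M) M := by
    intro hd
    obtain ⟨δ, hδ, hδ'⟩ := hd.exists_thickenings hclosed.isCompact hM
    obtain ⟨m, hm⟩ := hprox.exists_mul hs hδ
    have h1 := (hst.zsmul m p).1 hp
    have h2 := (hst.zsmul m _).1 hy
    have h3 : e ((T ^ (m * r : ℤ)) p.1, (T ^ (m * s : ℤ)) p.2) ∈ Metric.thickening δ (e '' M) :=
      Metric.self_subset_thickening hδ _ ⟨_, h1, rfl⟩
    refine disjoint_left.1 hδ' h3 (Metric.mem_thickening_iff.2 ⟨_, h2, ?_⟩)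
    simp only [he, ← homeomorph_zpow_add_apply, Prod.dist_eq]
    rw [add_comm i, dist_self, add_comm j, mul_comm m, homeomorph_zpow_add_apply _ _ j]
    exact max_lt hδ hm
  obtain ⟨_, ⟨q, hq, rfl⟩, hq'⟩ := not_disjoint_iff.1 hnd
  exact stabilizes_of_mem hM hrs hmin hq hq'

/-- A minimal set of `T ^ r × T ^ s` meets the diagonal unless `r ∣ s`. -/
theorem minimal_meets_diagonal_or_dvd [CompactSpace X] (hT : IsPOD T) {r s : ℕ} (hr : 0 < r)
    (hs : 0 < s) (hM : IsClosed M) (hne : M.Nonempty)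
    (hrs : ∀ p ∈ M, ((T ^ (r : ℤ)) p.1, (T ^ (s : ℤ)) p.2) ∈ M)
    (hmin : ∀ L : Set (X × X), IsClosed L → L.Nonempty →
      (∀ p ∈ L, ((T ^ (r : ℤ)) p.1, (T ^ (s : ℤ)) p.2) ∈ L) → L ⊆ M → L = M) :
    (∃ z, (z, z) ∈ M) ∨ r ∣ s := by
  obtain ⟨⟨x, y⟩, hxy⟩ := hne
  have hst : Stabilizes T M r s := stabilizes_of_forward hM ⟨_, hxy⟩ hrs hmin hrs
  have hproj : Prod.fst '' M = univ := by
    refine hT.1 r hr _ (hM.isCompact.image continuous_fst).isClosed ⟨x, _, hxy, rfl⟩ ?_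
    rintro _ ⟨q, hq, rfl⟩
    refine ⟨_, hrs q hq, ?_⟩
    simp [← coe_homeomorph_pow]
  obtain ⟨⟨x', y'⟩, hxy', hx'⟩ : T x ∈ Prod.fst '' M := hproj ▸ mem_univ _
  obtain rfl : x' = T x := hx'
  obtain ⟨n, hn⟩ : ∃ n : ℤ, Stabilizes T M 1 n := by
    by_cases hyy : y' = y
    · refine ⟨0, stabilizes_of_mem hM hrs hmin hxy ?_⟩
      subst hyy
      simpa using hxy'
    · obtain ⟨n, -, hn⟩ := hT.2 y' y hyy
      exact ⟨n, stabilizes_of_proximal hs hM hrs hmin (p := (x, y)) (y := y') hxy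
        (by simpa using hxy') hn⟩
  -- Subtracting `r` times `(1, n)` from `(r, s)` removes the first coordinate.
  have hc : Stabilizes T M 0 (s - r * n) := by
    have := hst.add (hn.zsmul (-r))
    simpa [sub_eq_add_neg] using this
  by_cases h0 : (s : ℤ) - r * n = 0
  · right
    exact Int.natCast_dvd_natCast.1 ⟨n, by linarith⟩
  left
  set c := ((s : ℤ) - r * n).natAbs with hcdef
  have hc' : Stabilizes T M 0 c := by
    rcases Int.natAbs_eq ((s : ℤ) - r * n) with h | h
    · rwa [h] at hc
    · rw [h] at hc; simpa only [neg_neg, neg_zero] using hc.neg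
  have : {z | (x, z) ∈ M} = univ := by
    refine hT.1 c (Int.natAbs_pos.2 h0) _ (hM.preimage (by fun_prop)) ⟨y, hxy⟩ ?_
    intro z hz
    have := (hc' _).1 hz
    simpa [← coe_homeomorph_pow] using this
  exact ⟨x, (this ▸ mem_univ x : x ∈ {z | (x, z) ∈ M})⟩

theorem IsPOD.meets_diagonal [CompactSpace X] (hT : IsPOD T) {r s : ℕ} (hr : 0 < r)
    (hs : 0 < s) (hne : r ≠ s) {K : Set (X × X)} (hK : IsClosed K) (hKne : K.Nonempty)
    (hrs : ∀ p ∈ K, ((T ^ (r : ℤ)) p.1, (T ^ (s : ℤ)) p.2) ∈ K) : ∃ z, (z, z) ∈ K := by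
  obtain ⟨M, hMK, hM, hMne, hMmap, hmin⟩ := exists_minimal_closed_mapsTo
    (fun p : X × X => ((T ^ (r : ℤ)) p.1, (T ^ (s : ℤ)) p.2)) hK hKne hrs
  suffices ∃ z, (z, z) ∈ M from this.imp fun z hz => hMK hz
  rcases minimal_meets_diagonal_or_dvd hT hr hs hM hMne hMmap hmin with h | h
  · exact h
  have h' := minimal_meets_diagonal_or_dvd (M := Prod.swap ⁻¹' M) hT hs hr
    (hM.preimage continuous_swap) (hMne.preimage Prod.swap_surjective) (fun p hp => hMmap hp) (by
      intro L h1 h2 h3 h4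
      have : Prod.swap ⁻¹' L = M := hmin _ (h1.preimage continuous_swap)
        (h2.preimage Prod.swap_surjective) (fun p hp => h3 _ hp) (fun p hp => by
          simpa using h4 hp)
      rw [← this, ← preimage_comp]; simp)
  rcases h' with h' | h'
  · exact h'
  · exact absurd (Nat.dvd_antisymm h h') hne

theorem IsPOD.prox_eq_univ [CompactSpace X] (hT : IsPOD T) {r s : ℕ} (hr : 0 < r)
    (hs : 0 < s) (hne : r ≠ s) : Prox T r s = univ := by
  refine eq_univ_of_forall fun ⟨x, y⟩ => ?_
  change liminf (fun n : ℕ => dist (T^[r * n] x) (T^[s * n] y)) atTop = 0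
  obtain ⟨C, hC⟩ := (Metric.isBounded_iff.1 (isCompact_univ (X := X)).isBounded)
  have hbdd : IsBoundedUnder (· ≥ ·) atTop
      (fun n : ℕ => dist (T^[r * n] x) (T^[s * n] y)) :=
    isBoundedUnder_of ⟨0, fun _ => dist_nonneg⟩
  have hcobdd : IsCoboundedUnder (· ≥ ·) atTop
      (fun n : ℕ => dist (T^[r * n] x) (T^[s * n] y)) :=
    IsBoundedUnder.isCoboundedUnder_ge (isBoundedUnder_of
      ⟨C, fun _ => hC (mem_univ _) (mem_univ _)⟩)
  refine le_antisymm (le_of_forall_pos_le_add fun ε hε => ?_)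
    (le_liminf_of_le hcobdd (Eventually.of_forall fun _ => dist_nonneg))
  rw [zero_add]
  refine liminf_le_of_frequently_le (frequently_atTop.2 fun a => ?_) hbdd
  have hmap : ∀ n : ℕ, ((T ^ (r : ℤ)) (T^[r * n] x), (T ^ (s : ℤ)) (T^[s * n] y)) =
      (T^[r * (n + 1)] x, T^[s * (n + 1)] y) := by
    intro n
    rw [zpow_natCast, zpow_natCast, coe_homeomorph_pow, coe_homeomorph_pow,
      ← Function.iterate_add_apply, ← Function.iterate_add_apply]
    ring_nf
  have hcont : Continuous fun p : X × X => ((T ^ (r : ℤ)) p.1, (T ^ (s : ℤ)) p.2) :=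
    ((T ^ (r : ℤ)).prodCongr (T ^ (s : ℤ))).continuous
  -- Using only times `≥ a` makes the diagonal approach occur arbitrarily late.
  obtain ⟨z, hz⟩ := hT.meets_diagonal hr hs hne
    (K := closure ((fun n : ℕ => (T^[r * n] x, T^[s * n] y)) '' Ici a)) isClosed_closure
    ⟨_, subset_closure ⟨a, self_mem_Ici, rfl⟩⟩ (by
      refine MapsTo.closure ?_ hcont
      rintro _ ⟨n, hn, rfl⟩
      exact ⟨n + 1, le_trans hn (Nat.le_succ n), (hmap n).symm⟩)
  obtain ⟨_, ⟨n, hn, rfl⟩, hd⟩ := Metric.mem_closure_iff.1 hz (ε / 2) (by positivity)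
  refine ⟨n, hn, ?_⟩
  rw [Prod.dist_eq, max_lt_iff] at hd
  have := dist_triangle_left (T^[r * n] x) (T^[s * n] y) z
  simp only at hd
  linarith [hd.1, hd.2]

theorem IsPOD.nontrivial_minimalPoints (hT : IsPOD T) (hX : Nontrivial X) :
    {x : X | IsMinimalPoint T x}.Nontrivial := by
  obtain ⟨x, y, hxy⟩ := hX.exists_pair_ne
  have h : ∀ z : X, IsMinimalPoint T z := fun z =>
    ⟨univ, isClosed_univ, mapsTo_univ _ _, mem_univ _, fun L h1 h2 h3 _ =>
      hT.1 1 one_pos L h1 h2 (by simpa using h3)⟩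
  exact ⟨x, h x, y, h y, hxy⟩

end Stabilizer

/-! ### Block lengths and their arithmetic. -/

/-- The lengths of the blocks of the rank-one system constructed below. -/
def towerHeight : ℕ → ℕ
  | 0 => 1
  | k + 1 => 4 * (k + 2) * towerHeight k * (towerHeight k + 1)

/-- The number of initial copies of the `k`-th block in the next one that are not preceded by a
spacer. -/
def towerReps (k : ℕ) : ℕ := (4 * k + 7) * (towerHeight k + 1)

theorem towerHeight_pos (k : ℕ) : 0 < towerHeight k := by
  induction k with
  | zero => exact one_pos
  | succ k ih => rw [towerHeight]; positivity

theorem towerHeight_succ (k : ℕ) :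
    towerHeight (k + 1) = towerReps k * towerHeight k + towerHeight k * (towerHeight k + 1) := by
  rw [towerHeight, towerReps]; ring

theorem lt_towerHeight (k : ℕ) : k < towerHeight k := by
  induction k with
  | zero => exact one_pos
  | succ k _ =>
    rw [towerHeight]
    have h : 1 ≤ 4 * towerHeight k * (towerHeight k + 1) := by
      have := towerHeight_pos k
      exact Nat.succ_le_of_lt (by positivity)
    nlinarith

/-- The factor `k + 2` in the recursion exists for this: modulo `m`, only spacers then move the
large blocks. -/
theorem dvd_towerHeight {m k : ℕ} (hm : 0 < m) (hk : m ≤ k + 1) : m ∣ towerHeight k := by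
  rcases m with _ | _ | m
  · omega
  · exact one_dvd _
  have hk' : m + 1 ≤ k := by omega
  induction k, hk' using Nat.le_induction with
  | base =>
    rw [towerHeight]
    exact Dvd.dvd.mul_right (Dvd.dvd.mul_right (Dvd.dvd.mul_left (by rfl) _) _) _
  | succ k _ ih =>
    rw [towerHeight]
    exact Dvd.dvd.mul_right (Dvd.dvd.mul_left (ih (by omega)) _) _

/-- The distance within which every block of one point has a block of another point. -/
def towerRadius (k : ℕ) : ℕ := (towerHeight k + 1) / 2

theorem towerRadius_succ (k : ℕ) :
    towerRadius (k + 1) = 2 * (k + 2) * towerHeight k * (towerHeight k + 1) := by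
  have : towerHeight (k + 1) = 2 * (2 * (k + 2) * towerHeight k * (towerHeight k + 1)) := by
    rw [towerHeight]; ring
  rw [towerRadius]; omega

/-! ### Combinatorics of offset families. -/

section Offsets

variable {A : ℕ → Set ℤ}

/-- `A k` contains an interval of length at least `t` around a small non-zero integer. -/
def HasInterval (A : ℕ → Set ℤ) (k t : ℕ) : Prop :=
  ∃ u v n : ℤ, u + t ≤ v ∧ u ≤ n ∧ n ≤ v ∧ n ≠ 0 ∧ |n| ≤ towerRadius k ∧ Icc u v ⊆ A k

/-- Here `d` is the rounding of `n / towerHeight k` to a nearest integer. -/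
theorem exists_quotient_towerRadius {k : ℕ} {n : ℤ} (h1 : (towerRadius k : ℤ) < n)
    (h2 : n ≤ towerRadius (k + 1)) :
    ∃ d : ℕ, 1 ≤ d ∧ d < towerReps k ∧ |n - d * towerHeight k| ≤ towerRadius k := by
  have hpos := towerHeight_pos k
  set h := towerHeight k with hh
  obtain ⟨m, rfl⟩ := Int.eq_ofNat_of_zero_le (le_trans (Int.natCast_nonneg _) h1.le)
  have h1' : towerRadius k < m := by exact_mod_cast h1
  have h2' : m ≤ towerRadius (k + 1) := by exact_mod_cast h2
  rw [towerRadius_succ, ← hh] at h2'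
  rw [towerRadius, ← hh] at h1' ⊢
  obtain ⟨d, e, hdm, hlt⟩ : ∃ d e, h * d + e = m + h / 2 ∧ e < h :=
    ⟨_, _, Nat.div_add_mod _ _, Nat.mod_lt _ hpos⟩
  refine ⟨d, ?_, ?_, ?_⟩
  · by_contra hd
    have : d = 0 := by omega
    rw [this] at hdm
    omega
  · rw [towerReps, ← hh]
    by_contra hd
    push Not at hd
    have : h * ((4 * k + 7) * (h + 1)) ≤ h * d := Nat.mul_le_mul_left _ hd
    nlinarith [Nat.zero_le (k * h * h), Nat.zero_le (k * h), Nat.zero_le (h * h),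
      Nat.div_le_self h 2]
  · have : (h : ℤ) * d + e = m + (h / 2 : ℕ) := by exact_mod_cast hdm
    rw [abs_le]
    have h3 : (m : ℤ) - d * h = e - (h / 2 : ℕ) := by linarith
    rw [h3]
    omega

theorem HasInterval.mono {k t t' : ℕ} (h : HasInterval A k t) (ht : t' ≤ t) :
    HasInterval A k t' := by
  obtain ⟨u, v, n, huv, h⟩ := h
  exact ⟨u, v, n, by omega, h⟩

/-- Families of offsets closed under moving to inner blocks. -/
def IsOffsetFamily (A : ℕ → Set ℤ) : Prop :=
  ∀ k, ∀ n ∈ A (k + 1), ∀ d e : ℕ, e ≤ d → d < towerReps k → e ≤ towerHeight k →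
    n - (d * towerHeight k + e) ∈ A k ∧ n + (d * towerHeight k + e) ∈ A k

theorem towerReps_pos (k : ℕ) : 0 < towerReps k := by rw [towerReps]; positivity

theorem IsOffsetFamily.antitone (hA : IsOffsetFamily A) : Antitone A :=
  antitone_nat_of_succ_le fun k n hn => by
    simpa using (hA k n hn 0 0 le_rfl (towerReps_pos k) (Nat.zero_le _)).1

/-- If `n` is too large for level `k`, translating by `d` block lengths brings it back into range,
and the choice between `e = 0` and `e = 1` lengthens the interval by one. -/
theorem IsOffsetFamily.descend_one (hA : IsOffsetFamily A) {k t : ℕ}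
    (h1 : (1 : ℤ) ∉ A k) (h1' : (-1 : ℤ) ∉ A k) {u v n : ℤ} (huv : u + t ≤ v) (hun : u ≤ n)
    (hnv : n ≤ v) (hnk : |n| ≤ towerRadius (k + 1)) (hsub : Icc u v ⊆ A (k + 1)) :
    |n| ≤ towerRadius k ∨ HasInterval A k (t + 1) := by
  have hpos := towerHeight_pos k
  rcases le_or_gt |n| (towerRadius k) with h | h
  · exact Or.inl h
  right
  rw [abs_le] at hnk
  rcases lt_abs.1 h with h | h
  · obtain ⟨d, hd1, hd2, hd3⟩ := exists_quotient_towerRadius h hnk.2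
    have hmem : Icc (u - d * towerHeight k - 1) (v - d * towerHeight k) ⊆ A k := by
      intro z hz
      rcases eq_or_ne z (u - d * towerHeight k - 1) with rfl | hz'
      · have := (hA k u (hsub ⟨le_rfl, by omega⟩) d 1 hd1 hd2 hpos).1
        convert this using 1; push_cast; ring
      · have hz'' : u - d * towerHeight k - 1 < z := lt_of_le_of_ne hz.1 hz'.symm
        have := (hA k (z + d * towerHeight k) (hsub ⟨by linarith [hz''], by linarith [hz.2]⟩)
          d 0 (Nat.zero_le _) hd2 (Nat.zero_le _)).1
        convert this using 1; push_cast; ring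
    -- Were the new centre zero, the added left end would put `-1` in `A k`.
    refine ⟨_, _, n - d * towerHeight k, ?_, ?_, ?_, fun h0 => h1' ?_, hd3, hmem⟩
    · push_cast; linarith
    · linarith
    · linarith
    · exact hmem ⟨by linarith, by linarith⟩
  · obtain ⟨d, hd1, hd2, hd3⟩ := exists_quotient_towerRadius h (by linarith)
    have hmem : Icc (u + d * towerHeight k) (v + d * towerHeight k + 1) ⊆ A k := by
      intro z hz
      rcases eq_or_ne z (v + d * towerHeight k + 1) with rfl | hz'
      · have := (hA k v (hsub ⟨by omega, le_rfl⟩) d 1 hd1 hd2 hpos).2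
        convert this using 1; push_cast; ring
      · have hz'' : z < v + d * towerHeight k + 1 := lt_of_le_of_ne hz.2 hz'
        have := (hA k (z - d * towerHeight k) (hsub ⟨by linarith [hz.1], by linarith [hz'']⟩)
          d 0 (Nat.zero_le _) hd2 (Nat.zero_le _)).2
        convert this using 1; push_cast; ring
    refine ⟨_, _, n + d * towerHeight k, ?_, ?_, ?_, fun h0 => h1 ?_, ?_, hmem⟩
    · push_cast; linarith
    · linarith
    · linarith
    · exact hmem ⟨by linarith, by linarith⟩
    · rw [← abs_neg]; convert hd3 using 2; ring

theorem IsOffsetFamily.descend (hA : IsOffsetFamily A) {k : ℕ} (h1 : (1 : ℤ) ∉ A k)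
    (h1' : (-1 : ℤ) ∉ A k) (j : ℕ) {t : ℕ} {u v n : ℤ} (huv : u + t ≤ v) (hun : u ≤ n)
    (hnv : n ≤ v) (hn : n ≠ 0) (hnk : |n| ≤ towerRadius (k + j)) (hsub : Icc u v ⊆ A (k + j)) :
    |n| ≤ towerRadius k ∨ HasInterval A k (t + 1) := by
  induction j generalizing t u v n with
  | zero => exact Or.inl hnk
  | succ j ih =>
    have hle : A (k + j) ⊆ A k := hA.antitone (Nat.le_add_right _ _)
    rcases hA.descend_one (k := k + j) (fun h => h1 (hle h)) (fun h => h1' (hle h)) huv hun hnv hnk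
      hsub with h | ⟨u', v', n', huv', hun', hnv', hn', hnk', hsub'⟩
    · exact ih huv hun hnv hn h (hsub.trans (hA.antitone (Nat.le_succ _)))
    · right
      rcases ih huv' hun' hnv' hn' hnk' hsub' with h | h
      · exact ⟨u', v', n', huv', hun', hnv', hn', h, hsub'.trans hle⟩
      · exact h.mono (Nat.le_succ _)

/-- Divide `towerRadius (k + 1) - 1` by the block length: the quotient exceeds the remainder, so
this is an admissible displacement, and it leaves `±1`. -/
theorem IsOffsetFamily.mem_of_towerRadius (hA : IsOffsetFamily A) {k : ℕ} :
    ((towerRadius (k + 1) : ℤ) ∈ A (k + 1) → (1 : ℤ) ∈ A k) ∧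
      (-(towerRadius (k + 1) : ℤ) ∈ A (k + 1) → (-1 : ℤ) ∈ A k) := by
  have hpos := towerHeight_pos k
  obtain ⟨d, e, hed, hd, he, heq⟩ : ∃ d e : ℕ, e ≤ d ∧ d < towerReps k ∧ e ≤ towerHeight k ∧
      towerRadius (k + 1) = d * towerHeight k + e + 1 := by
    have hR := towerRadius_succ k
    set h := towerHeight k with hh
    set R := towerRadius (k + 1)
    have hR1 : h * (h + 1) + 1 ≤ R := by rw [hR]; nlinarith
    have hdm := Nat.div_add_mod (R - 1) h
    have hlt := Nat.mod_lt (R - 1) hpos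
    set d := (R - 1) / h with hdd
    set e := (R - 1) % h
    have hle : h + 1 ≤ d := (Nat.le_div_iff_mul_le hpos).2 (by rw [mul_comm]; omega)
    refine ⟨d, e, by omega, ?_, hlt.le, by rw [mul_comm d]; omega⟩
    rw [towerReps, ← hh]
    refine (Nat.div_lt_iff_lt_mul hpos).2 ?_
    have : R < (4 * k + 7) * (h + 1) * h := by rw [hR]; nlinarith
    omega
  rw [heq]
  refine ⟨fun h => ?_, fun h => ?_⟩
  · have := (hA k _ h d e hed hd he).1
    convert this using 1; push_cast; ring
  · have := (hA k _ h d e hed hd he).2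
    convert this using 1; push_cast; ring

theorem IsOffsetFamily.exists_common (hA : IsOffsetFamily A)
    (hne : ∀ k, ∃ n ∈ A k, n ≠ 0 ∧ |n| ≤ towerRadius k) : ∃ n : ℤ, n ≠ 0 ∧ ∀ k, n ∈ A k := by
  by_contra! H
  have hbd : ∀ C : ℤ, ∃ K, ∀ k ≥ K, ∀ n : ℤ, n ≠ 0 → |n| ≤ C → n ∉ A k := by
    intro C
    have H' : ∀ n : ℤ, ∃ k, n ≠ 0 → n ∉ A k := fun n => by
      by_cases hn : n = 0
      · exact ⟨0, fun h => absurd hn h⟩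
      · obtain ⟨k, hk⟩ := H n hn
        exact ⟨k, fun _ => hk⟩
    choose f hf using H'
    refine ⟨(Finset.Icc (-C) C).sup f, fun k hk n hn hnC hmem => hf n hn ?_⟩
    exact hA.antitone ((Finset.le_sup (Finset.mem_Icc.2 (abs_le.1 hnC))).trans hk) hmem
  obtain ⟨K, hK⟩ := hbd 1
  have h1 : ∀ k ≥ K, (1 : ℤ) ∉ A k := fun k hk => hK k hk 1 one_ne_zero (by simp)
  have h1' : ∀ k ≥ K, (-1 : ℤ) ∉ A k := fun k hk => hK k hk (-1) (by simp) (by simp)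
  have hP : ∀ t : ℕ, ∀ k ≥ K, HasInterval A k t := by
    intro t
    induction t with
    | zero =>
      intro k _
      obtain ⟨n, hn, hn0, hnk⟩ := hne k
      exact ⟨n, n, n, by simp, le_rfl, le_rfl, hn0, hnk, by simpa using hn⟩
    | succ t ih =>
      intro k hk
      -- From level `K'` on, non-zero offsets exceed the radius of level `k`, so the descent must
      -- gain length.
      obtain ⟨K', hK'⟩ := hbd (towerRadius k)
      obtain ⟨u, v, n, huv, hun, hnv, hn, hnk, hsub⟩ := ih (k + K') (by omega)
      rcases hA.descend (h1 k hk) (h1' k hk) K' huv hun hnv hn hnk hsub with h | h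
      · exact absurd (hsub ⟨hun, hnv⟩) (hK' _ (Nat.le_add_left _ _) n hn h)
      · exact h
  -- An interval of length twice the radius that contains a point within the radius of zero contains
  -- one of the two endpoints `±towerRadius (K + 1)`.
  obtain ⟨u, v, n, huv, hun, hnv, -, hnk, hsub⟩ :=
    hP (2 * towerRadius (K + 1)) (K + 1) (Nat.le_succ _)
  rw [abs_le] at hnk
  push_cast at huv
  rcases le_total (towerRadius (K + 1) : ℤ) v with h | h
  · exact h1 K le_rfl (hA.mem_of_towerRadius.1 (hsub ⟨by linarith, h⟩))
  · exact h1' K le_rfl (hA.mem_of_towerRadius.2 (hsub ⟨by linarith, by linarith⟩))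

end Offsets

/-! ### Blocks and the positions of their copies. -/

/-- The position of the `i`-th copy of the `k`-th block inside the next block. -/
def blockPos (k i : ℕ) : ℕ := i * towerHeight k + (i + 1 - towerReps k)

/-- The blocks of a rank-one system with spacer `true`: the next block consists of `towerReps k`
copies of the `k`-th one, followed by `towerHeight k` copies that are preceded by a spacer. -/
def towerWord : ℕ → ℕ → Bool
  | 0, _ => false
  | k + 1, t =>
    if t < towerReps k * towerHeight k then towerWord k (t % towerHeight k)
    else if (t - towerReps k * towerHeight k) % (towerHeight k + 1) = 0 then true
    else towerWord k ((t - towerReps k * towerHeight k) % (towerHeight k + 1) - 1)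

theorem towerWord_blockPos (k i : ℕ) {t : ℕ} (ht : t < towerHeight k) :
    towerWord (k + 1) (blockPos k i + t) = towerWord k t := by
  rw [towerWord, blockPos]
  rcases lt_or_ge i (towerReps k) with hi | hi
  · have h0 : i + 1 - towerReps k = 0 := by omega
    have h1 : (i + 1) * towerHeight k ≤ towerReps k * towerHeight k := Nat.mul_le_mul_right _ hi
    have h2 : i * towerHeight k + t < towerReps k * towerHeight k := by
      rw [add_mul] at h1; omega
    rw [h0, add_zero, if_pos h2, add_comm, Nat.add_mul_mod_self_right, Nat.mod_eq_of_lt ht]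
  · obtain ⟨j, rfl⟩ := Nat.exists_eq_add_of_le hi
    have h0 : towerReps k + j + 1 - towerReps k = j + 1 := by omega
    have h1 : (towerReps k + j) * towerHeight k + (j + 1) + t =
        towerReps k * towerHeight k + ((t + 1) + j * (towerHeight k + 1)) := by ring
    rw [h0, h1, if_neg (by omega), Nat.add_sub_cancel_left, Nat.add_mul_mod_self_right,
      Nat.mod_eq_of_lt (by omega), if_neg (by omega), Nat.add_sub_cancel]

theorem towerWord_spacer {k i : ℕ} (hi : towerReps k ≤ i + 1) :
    towerWord (k + 1) (blockPos k i + towerHeight k) = true := by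
  rw [towerWord, blockPos]
  obtain ⟨j, hj⟩ := Nat.exists_eq_add_of_le hi
  have h0 : i + 1 - towerReps k = j := by omega
  have h1 : i * towerHeight k + j + towerHeight k =
      towerReps k * towerHeight k + j * (towerHeight k + 1) := by
    have : i * towerHeight k + towerHeight k = (towerReps k + j) * towerHeight k := by
      rw [← hj]; ring
    rw [add_right_comm, this]; ring
  rw [h0, h1, if_neg (by omega), Nat.add_sub_cancel_left, Nat.mul_mod_left, if_pos rfl]

theorem blockPos_zero (k : ℕ) : blockPos k 0 = 0 := by
  have : 1 ≤ towerReps k := towerReps_pos k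
  rw [blockPos]; omega

theorem blockPos_of_lt {k i : ℕ} (hi : i < towerReps k) : blockPos k i = i * towerHeight k := by
  rw [blockPos]; omega

/-- The `e` spacers met so far appear as the final summand; both the offset displacements and the
residues modulo `m` come from it. -/
theorem blockPos_add (k e : ℕ) :
    blockPos k (towerReps k - 1 + e) = (towerReps k - 1 + e) * towerHeight k + e := by
  have := towerReps_pos k
  rw [blockPos]; omega

theorem blockPos_succ_of_lt {k i : ℕ} (hi : i + 1 < towerReps k) :
    blockPos k (i + 1) = blockPos k i + towerHeight k := by
  rw [blockPos_of_lt hi, blockPos_of_lt (by omega)]; ring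

theorem blockPos_succ_of_ge {k i : ℕ} (hi : towerReps k ≤ i + 1) :
    blockPos k (i + 1) = blockPos k i + towerHeight k + 1 := by
  rw [blockPos, blockPos, add_mul]; omega

theorem blockPos_last (k : ℕ) :
    blockPos k (towerReps k + towerHeight k - 1) + towerHeight k = towerHeight (k + 1) := by
  have h1 := towerReps_pos k
  obtain ⟨N, hN⟩ : ∃ N, towerReps k = N + 1 := ⟨towerReps k - 1, by omega⟩
  rw [blockPos, towerHeight_succ, hN,
    show N + 1 + towerHeight k - 1 = N + towerHeight k by omega,
    show N + towerHeight k + 1 - (N + 1) = towerHeight k by omega]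
  ring

theorem exists_blockPos_le {k a : ℕ} (ha : a ≤ towerHeight (k + 1)) :
    ∃ i < towerReps k + towerHeight k, blockPos k i ≤ a ∧ a ≤ blockPos k i + towerHeight k := by
  have h1 := towerReps_pos k
  set n := towerReps k + towerHeight k - 1 with hn
  set i := Nat.findGreatest (fun i => blockPos k i ≤ a) n with hi
  have hin : i ≤ n := Nat.findGreatest_le n
  have hia : blockPos k i ≤ a :=
    Nat.findGreatest_spec (P := fun i => blockPos k i ≤ a) (Nat.zero_le n) (by simp [blockPos_zero])
  refine ⟨i, by omega, hia, ?_⟩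
  rcases eq_or_lt_of_le hin with h | h
  · rw [h, hn, blockPos_last]; exact ha
  · have : ¬ blockPos k (i + 1) ≤ a :=
      Nat.findGreatest_is_greatest (P := fun i => blockPos k i ≤ a) (Nat.lt_succ_self i) h
    rcases lt_or_ge (i + 1) (towerReps k) with h' | h'
    · rw [blockPos_succ_of_lt h'] at this; omega
    · rw [blockPos_succ_of_ge h'] at this; omega

/-! ### Concatenations of blocks and the subshift. -/

/-- The `k`-th block occurs in `x` at position `p`. -/
def OccursAt (k : ℕ) (x : ℤ → Bool) (p : ℤ) : Prop :=
  ∀ t : ℕ, t < towerHeight k → x (p + t) = towerWord k t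

theorem OccursAt.inner {k : ℕ} {x : ℤ → Bool} {p : ℤ} (h : OccursAt (k + 1) x p) {i : ℕ}
    (hi : i < towerReps k + towerHeight k) : OccursAt k x (p + blockPos k i) := by
  intro t ht
  have hlt : blockPos k i + t < towerHeight (k + 1) := by
    rw [← blockPos_last]
    have hmono : blockPos k i ≤ blockPos k (towerReps k + towerHeight k - 1) := by
      have : i ≤ towerReps k + towerHeight k - 1 := by omega
      have := Nat.mul_le_mul_right (towerHeight k) this
      rw [blockPos, blockPos]; omega
    omega
  have := h _ hlt
  rw [towerWord_blockPos k i ht] at this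
  rw [← this]; push_cast; ring_nf

/-- `x` is a concatenation of copies of the `k`-th block, starting at the positions in `S`, any two
consecutive copies being separated by at most one spacer. -/
structure IsTower (k : ℕ) (x S : ℤ → Bool) : Prop where
  occursAt : ∀ p, S p = true → OccursAt k x p
  next : ∀ p, S p = true → S (p + towerHeight k) = true ∨
    (x (p + towerHeight k) = true ∧ S (p + towerHeight k + 1) = true)
  cover : ∀ a : ℤ, ∃ j ∈ Finset.range (towerHeight k + 1), S (a - (j : ℕ)) = true

theorem IsTower.of_succ {k : ℕ} {x S : ℤ → Bool} (h : IsTower (k + 1) x S) :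
    ∃ S', IsTower k x S' := by
  classical
  have h1 := towerReps_pos k
  have h2 := towerHeight_pos k
  refine ⟨fun p => decide (∃ i < towerReps k + towerHeight k, S (p - blockPos k i) = true),
    ?_, ?_, ?_⟩
  · intro p hp
    obtain ⟨i, hi, hp⟩ := of_decide_eq_true hp
    simpa using (h.occursAt _ hp).inner hi
  · intro p hp
    obtain ⟨i, hi, hp⟩ := of_decide_eq_true hp
    simp only [decide_eq_true_eq]
    rcases eq_or_lt_of_le (Nat.le_sub_one_of_lt hi) with hlast | hlt
    · have e : (blockPos k i : ℤ) + towerHeight k = towerHeight (k + 1) := by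
        rw [hlast]; exact_mod_cast blockPos_last k
      have e' : p - blockPos k i + towerHeight (k + 1) = p + towerHeight k := by linarith
      rcases h.next _ hp with hn | ⟨hx, hn⟩
      · left
        refine ⟨0, by omega, ?_⟩
        rw [blockPos_zero]; simpa [e'] using hn
      · right
        refine ⟨by rwa [e'] at hx, 0, by omega, ?_⟩
        rw [blockPos_zero]; simpa [e'] using hn
    · rcases lt_or_ge (i + 1) (towerReps k) with h' | h'
      · left
        refine ⟨i + 1, by omega, ?_⟩
        rw [blockPos_succ_of_lt h']; convert hp using 2; push_cast; ring
      · right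
        refine ⟨?_, i + 1, by omega, ?_⟩
        · have hlt' : blockPos k i + towerHeight k < towerHeight (k + 1) := by
            have e1 := blockPos_succ_of_ge h'
            have e2 := blockPos_last k
            have e3 : blockPos k (i + 1) ≤ blockPos k (towerReps k + towerHeight k - 1) := by
              have : i + 1 ≤ towerReps k + towerHeight k - 1 := by omega
              have := Nat.mul_le_mul_right (towerHeight k) this
              rw [blockPos, blockPos]; omega
            omega
          have := h.occursAt _ hp _ hlt'
          rw [towerWord_spacer h'] at this
          convert this using 2; push_cast; ring
        · rw [blockPos_succ_of_ge h']; convert hp using 2; push_cast; ring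
  · intro a
    obtain ⟨j, hj, hS⟩ := h.cover a
    obtain ⟨i, hi, hia, hai⟩ := exists_blockPos_le (k := k) (a := j)
      (by rw [Finset.mem_range] at hj; omega)
    refine ⟨j - blockPos k i, by rw [Finset.mem_range]; omega, ?_⟩
    simp only [decide_eq_true_eq]
    refine ⟨i, hi, ?_⟩
    convert hS using 2
    push_cast [hia]; ring

theorem isTower_periodic (k : ℕ) :
    IsTower k (fun a => towerWord k (a % (towerHeight k : ℤ)).toNat)
      (fun p => decide ((towerHeight k : ℤ) ∣ p)) := by
  have hpos : (0 : ℤ) < towerHeight k := by exact_mod_cast towerHeight_pos k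
  refine ⟨?_, ?_, ?_⟩
  · intro p hp t ht
    obtain ⟨c, rfl⟩ := of_decide_eq_true hp
    simp only
    rw [Int.mul_add_emod_self_left, Int.emod_eq_of_lt (by omega) (by omega), Int.toNat_natCast]
  · intro p hp
    left
    simpa using of_decide_eq_true hp
  · intro a
    have h1 := Int.emod_nonneg a hpos.ne'
    have h2 := Int.emod_lt_of_pos a hpos
    refine ⟨(a % (towerHeight k : ℤ)).toNat, by rw [Finset.mem_range]; omega, ?_⟩
    rw [Int.toNat_of_nonneg h1]
    simpa using Int.dvd_self_sub_emod

/-- The sequences that are concatenations of `k`-th blocks. -/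
def towerSet (k : ℕ) : Set (ℤ → Bool) := {x | ∃ S, IsTower k x S}

/-- The conditions on a pair `(x, S)` are closed, and projecting away the compact factor of the `S`
keeps the set closed. -/
theorem isClosed_towerSet (k : ℕ) : IsClosed (towerSet k) := by
  have hx : ∀ (i : ℤ) (b : Bool), IsClopen {q : (ℤ → Bool) × (ℤ → Bool) | q.1 i = b} := fun i b =>
    (isClopen_discrete {b}).preimage
      (by fun_prop : Continuous fun q : (ℤ → Bool) × (ℤ → Bool) => q.1 i)
  have hS : ∀ i : ℤ, IsClopen {q : (ℤ → Bool) × (ℤ → Bool) | q.2 i = true} := fun i =>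
    (isClopen_discrete {true}).preimage
      (by fun_prop : Continuous fun q : (ℤ → Bool) × (ℤ → Bool) => q.2 i)
  have h1 : IsClosed {q : (ℤ → Bool) × (ℤ → Bool) | ∀ p, q.2 p = true → OccursAt k q.1 p} := by
    simp only [OccursAt, ofPred_forall]
    refine isClosed_iInter fun p => ?_
    exact isClosed_imp (hS p).isOpen (by
      simp only [ofPred_forall]
      exact isClosed_iInter fun t => isClosed_iInter fun _ => (hx _ _).isClosed)
  have h2 : IsClosed {q : (ℤ → Bool) × (ℤ → Bool) | ∀ p, q.2 p = true →
      q.2 (p + towerHeight k) = true ∨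
        (q.1 (p + towerHeight k) = true ∧ q.2 (p + towerHeight k + 1) = true)} := by
    rw [ofPred_forall]
    exact isClosed_iInter fun p => isClosed_imp (hS p).isOpen
      ((hS _).isClosed.union ((hx _ _).isClosed.inter (hS _).isClosed))
  have h3 : IsClosed {q : (ℤ → Bool) × (ℤ → Bool) | ∀ a : ℤ,
      ∃ j ∈ Finset.range (towerHeight k + 1), q.2 (a - (j : ℕ)) = true} := by
    rw [ofPred_forall]
    refine isClosed_iInter fun a => ?_
    have : {q : (ℤ → Bool) × (ℤ → Bool) |
        ∃ j ∈ Finset.range (towerHeight k + 1), q.2 (a - (j : ℕ)) = true} =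
        ⋃ j ∈ Finset.range (towerHeight k + 1), {q | q.2 (a - (j : ℕ)) = true} := by
      ext q; simp
    rw [this]
    exact isClosed_biUnion_finset fun j _ => (hS _).isClosed
  have heq : towerSet k = Prod.fst '' {q : (ℤ → Bool) × (ℤ → Bool) | IsTower k q.1 q.2} := by
    ext x
    exact ⟨fun ⟨S, h⟩ => ⟨(x, S), h, rfl⟩, fun ⟨q, h, hq⟩ => ⟨q.2, hq ▸ h⟩⟩
  rw [heq]
  have hcl : IsClosed {q : (ℤ → Bool) × (ℤ → Bool) | IsTower k q.1 q.2} := by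
    convert h1.inter (h2.inter h3) using 1
    ext q
    exact ⟨fun h => ⟨h.1, h.2, h.3⟩, fun h => ⟨h.1, h.2.1, h.2.2⟩⟩
  exact (hcl.isCompact.image continuous_fst).isClosed

/-- The rank-one subshift with the blocks `towerWord`. -/
def towerSubshift : Set (ℤ → Bool) := ⋂ k, towerSet k

theorem isClosed_towerSubshift : IsClosed towerSubshift := isClosed_iInter isClosed_towerSet

theorem towerSubshift_nonempty : towerSubshift.Nonempty :=
  IsCompact.nonempty_iInter_of_sequence_nonempty_isCompact_isClosed towerSet
    (fun _ _ ⟨_, h⟩ => h.of_succ) (fun k => ⟨_, _, isTower_periodic k⟩)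
    (isClosed_towerSet 0).isCompact isClosed_towerSet

theorem shift_mem_towerSubshift {x : ℤ → Bool} (hx : x ∈ towerSubshift) (n : ℤ) :
    (fun i => x (i + n)) ∈ towerSubshift := by
  refine mem_iInter.2 fun k => ?_
  obtain ⟨S, hS⟩ := mem_iInter.1 hx k
  refine ⟨fun p => S (p + n), fun p hp t ht => ?_, fun p hp => ?_, fun a => ?_⟩
  · have := hS.occursAt _ hp t ht
    rwa [add_right_comm] at this
  · have := hS.next _ hp
    rwa [add_right_comm p n, add_right_comm _ n 1] at this
  · obtain ⟨j, hj, h⟩ := hS.cover (a + n)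
    refine ⟨j, hj, ?_⟩
    rw [← h]; ring_nf

/-! ### The shift and its powers. -/

/-- The `n`-th power of the shift on the rank-one subshift. -/
def towerShift (n : ℤ) : towerSubshift ≃ₜ towerSubshift where
  toFun x := ⟨fun i => x.1 (i + n), shift_mem_towerSubshift x.2 n⟩
  invFun x := ⟨fun i => x.1 (i + -n), shift_mem_towerSubshift x.2 (-n)⟩
  left_inv x := by ext i; simp
  right_inv x := by ext i; simp
  continuous_toFun := Continuous.subtype_mk
    (continuous_pi fun i =>
    (continuous_apply (A := fun _ : ℤ => Bool) (i + n)).comp continuous_subtype_val) _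
  continuous_invFun := Continuous.subtype_mk
    (continuous_pi fun i =>
    (continuous_apply (A := fun _ : ℤ => Bool) (i + -n)).comp continuous_subtype_val) _

theorem towerShift_apply (n : ℤ) (x : towerSubshift) (i : ℤ) :
    (towerShift n x).1 i = x.1 (i + n) := rfl

theorem towerShift_mul (m n : ℤ) : towerShift m * towerShift n = towerShift (m + n) := by
  ext x i
  rw [Homeomorph.mul_apply, towerShift_apply, towerShift_apply, towerShift_apply, add_assoc]

theorem towerShift_one_zpow (n : ℤ) : towerShift 1 ^ n = towerShift n := by
  have h0 : towerShift 0 = 1 := by ext x i; simp [towerShift_apply]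
  have hinv : (towerShift 1)⁻¹ = towerShift (-1) :=
    inv_eq_of_mul_eq_one_right (by rw [towerShift_mul, add_neg_cancel, h0])
  induction n with
  | zero => rw [zpow_zero, h0]
  | succ n ih => rw [zpow_add_one, ih, towerShift_mul]
  | pred n ih => rw [zpow_sub_one, ih, hinv, towerShift_mul, sub_eq_add_neg]

theorem towerShift_one_iterate (n : ℕ) : (towerShift 1)^[n] = towerShift n := by
  rw [← coe_homeomorph_pow, ← zpow_natCast, towerShift_one_zpow]

instance : CompactSpace towerSubshift :=
  isCompact_iff_compactSpace.1 isClosed_towerSubshift.isCompact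

/-- In a compact metrizable space of sequences, sequences that agree near the origin are close. -/
theorem exists_forall_dist_lt_of_agree {s : Set (ℤ → Bool)} [CompactSpace s] (d : s × s → ℝ)
    (hd : Continuous d) (hd0 : ∀ x, d (x, x) = 0) {ε : ℝ} (hε : 0 < ε) :
    ∃ L : ℕ, ∀ x y : s, (∀ i : ℤ, |i| ≤ L → x.1 i = y.1 i) → d (x, y) < ε := by
  by_contra! H
  have hcl : ∀ L : ℕ, IsClosed {q : s × s | (∀ i : ℤ, |i| ≤ L → q.1.1 i = q.2.1 i) ∧ ε ≤ d q} := by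
    intro L
    rw [ofPred_and]
    refine IsClosed.inter ?_ (isClosed_le continuous_const hd)
    simp only [ofPred_forall]
    refine isClosed_iInter fun i => isClosed_iInter fun _ => isClosed_eq ?_ ?_
    · exact (continuous_apply i).comp (continuous_subtype_val.comp continuous_fst)
    · exact (continuous_apply i).comp (continuous_subtype_val.comp continuous_snd)
  obtain ⟨⟨x, y⟩, hq⟩ := IsCompact.nonempty_iInter_of_sequence_nonempty_isCompact_isClosed
    (fun L : ℕ => {q : s × s | (∀ i : ℤ, |i| ≤ L → q.1.1 i = q.2.1 i) ∧ ε ≤ d q})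
    (fun L q hq => ⟨fun i hi => hq.1 i (by push_cast; linarith), hq.2⟩)
    (fun L => by obtain ⟨x, y, h1, h2⟩ := H L; exact ⟨(x, y), h1, h2⟩)
    (hcl 0).isCompact hcl
  rw [mem_iInter] at hq
  have hxy : x = y := by
    refine Subtype.ext (funext fun i => ?_)
    exact (hq i.natAbs).1 i (by simp)
  have := (hq 0).2
  rw [hxy, hd0] at this
  linarith

/-! ### Offsets between two points, and proximality. -/

/-- The offsets between the occurrences of the `k`-th block in two sequences. -/
def blockOffsets (x y : ℤ → Bool) (k : ℕ) : Set ℤ :=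
  {n | ∃ p, OccursAt k x p ∧ OccursAt k y (p + n)}

/-- Copies `N - 1 + e` and `N - 1 + e - d`, with `N = towerReps k`, lie `d * towerHeight k + e`
apart. Taking one in `x` and the other in `y` gives both signs. -/
theorem isOffsetFamily_blockOffsets (x y : ℤ → Bool) : IsOffsetFamily (blockOffsets x y) := by
  rintro k n ⟨p, hx, hy⟩ d e hed hd he
  have h1 := towerReps_pos k
  have h2 := blockPos_add k e
  have h3 : blockPos k (towerReps k - 1 + e - d) = (towerReps k - 1 + e - d) * towerHeight k :=
    blockPos_of_lt (by omega)
  have h4 : (towerReps k - 1 + e) * towerHeight k =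
      (towerReps k - 1 + e - d) * towerHeight k + d * towerHeight k := by
    rw [← add_mul]; congr 1; omega
  have h5 : (blockPos k (towerReps k - 1 + e) : ℤ) =
      blockPos k (towerReps k - 1 + e - d) + d * towerHeight k + e := by
    rw [h2, h3, h4]; push_cast; ring
  refine ⟨⟨_, hx.inner (i := towerReps k - 1 + e) (by omega), ?_⟩,
    ⟨_, hx.inner (i := towerReps k - 1 + e - d) (by omega), ?_⟩⟩
  · convert hy.inner (i := towerReps k - 1 + e - d) (by omega) using 1
    rw [h5]; ring
  · convert hy.inner (i := towerReps k - 1 + e) (by omega) using 1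
    rw [h5]; ring

theorem IsTower.eq_of_isTower {k : ℕ} {x y S : ℤ → Bool} (hx : IsTower k x S)
    (hy : IsTower k y S) : x = y := by
  have hpos := towerHeight_pos k
  have hocc : ∀ {p : ℤ} {t : ℕ}, S p = true → t < towerHeight k → x (p + t) = y (p + t) :=
    fun hp ht => (hx.occursAt _ hp _ ht).trans (hy.occursAt _ hp _ ht).symm
  ext1 a
  obtain ⟨j, hj, hS⟩ := hx.cover a
  rw [Finset.mem_range] at hj
  rcases Nat.lt_succ_iff_lt_or_eq.1 hj with hj | rfl
  · simpa using hocc hS hj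
  · have h1 := hx.next _ hS
    have h2 := hy.next _ hS
    rw [sub_add_cancel] at h1 h2
    have h0 : S a = true → x a = y a := fun h => by simpa using hocc h hpos
    rcases h1 with h1 | ⟨h1, -⟩
    · exact h0 h1
    · rcases h2 with h2 | ⟨h2, -⟩
      · exact h0 h2
      · rw [h1, h2]

/-- Around each block start of one point, a centred window of `towerHeight k + 1` places contains a
start of the other. If only offset zero occurred, the starts would agree, and they determine the
sequence. -/
theorem exists_blockOffset_ne_zero {x y : ℤ → Bool} (hx : x ∈ towerSubshift)
    (hy : y ∈ towerSubshift) (hxy : x ≠ y) (k : ℕ) :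
    ∃ n ∈ blockOffsets x y k, n ≠ 0 ∧ |n| ≤ towerRadius k := by
  by_contra! H
  obtain ⟨S, hS⟩ := mem_iInter.1 hx k
  obtain ⟨S', hS'⟩ := mem_iInter.1 hy k
  have H' : ∀ n ∈ blockOffsets x y k, |n| ≤ towerRadius k → n = 0 := fun n hn hk => by
    by_contra h0
    exact absurd hk (not_le.2 (H n hn h0))
  have hrad : ∀ j ∈ Finset.range (towerHeight k + 1),
      |((towerHeight k / 2 : ℕ) : ℤ) - (j : ℕ)| ≤ towerRadius k := by
    intro j hj
    rw [Finset.mem_range] at hj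
    rw [abs_le, towerRadius]
    omega
  have h1 : ∀ p, S p = true → S' p = true := by
    intro p hp
    obtain ⟨j, hj, hq⟩ := hS'.cover (p + (towerHeight k / 2 : ℕ))
    rw [add_sub_assoc] at hq
    have := H' _ ⟨p, hS.occursAt p hp, hS'.occursAt _ hq⟩ (hrad j hj)
    rwa [this, add_zero] at hq
  have h2 : ∀ p, S' p = true → S p = true := by
    intro q hq
    obtain ⟨j, hj, hp⟩ := hS.cover (q + (towerHeight k / 2 : ℕ))
    rw [add_sub_assoc] at hp
    have := H' (-(((towerHeight k / 2 : ℕ) : ℤ) - (j : ℕ)))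
      ⟨_, hS.occursAt _ hp, by rw [add_assoc, add_neg_cancel, add_zero]; exact hS'.occursAt q hq⟩
      (by rw [abs_neg]; exact hrad j hj)
    rwa [neg_eq_zero.1 this, add_zero] at hp
  have h3 : S' = S := by
    ext1 p
    exact Bool.eq_iff_iff.2 ⟨h2 p, h1 p⟩
  exact hxy (hS.eq_of_isTower (h3 ▸ hS'))

/-- Two distinct points share arbitrarily long blocks after a fixed non-zero shift. -/
theorem exists_shift_agree {x y : ℤ → Bool} (hx : x ∈ towerSubshift) (hy : y ∈ towerSubshift)
    (hxy : x ≠ y) : ∃ n : ℤ, n ≠ 0 ∧ ∀ L : ℕ, ∃ m : ℤ, ∀ i : ℤ, |i| ≤ L →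
      y (i + m + n) = x (i + m) := by
  obtain ⟨n, hn, h⟩ := (isOffsetFamily_blockOffsets x y).exists_common
    (exists_blockOffset_ne_zero hx hy hxy)
  refine ⟨n, hn, fun L => ?_⟩
  -- This block is longer than the window of `2 * L + 1` places.
  obtain ⟨p, hp, hq⟩ := h (2 * L + 1)
  have hlt := lt_towerHeight (2 * L + 1)
  refine ⟨p + L, fun i hi => ?_⟩
  rw [abs_le] at hi
  obtain ⟨t, ht⟩ := Int.eq_ofNat_of_zero_le (show 0 ≤ i + L by omega)
  have h1 := hp t (by omega)
  have h2 := hq t (by omega)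
  rw [show i + (p + L) + n = p + n + t by omega, h2,
    show i + (p + L) = p + t by omega, h1]

/-! ### Total minimality and the final example. -/

/-- Every window of a point of the subshift occurs in a block. -/
theorem exists_window_eq_towerWord {z : ℤ → Bool} (hz : z ∈ towerSubshift) {L k : ℕ}
    (hk : 2 * L < k) : ∃ a : ℤ, ∀ i : ℤ, |i| ≤ L →
      ∃ t : ℕ, t < towerHeight (k + 1) ∧ i + a = t ∧ z i = towerWord (k + 1) t := by
  obtain ⟨S, hS⟩ := mem_iInter.1 hz k
  have hlt := lt_towerHeight k
  have hN : 7 ≤ towerReps k := by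
    rw [towerReps]; nlinarith [Nat.zero_le (k * towerHeight k)]
  have hH : towerReps k * towerHeight k + towerHeight k ≤ towerHeight (k + 1) := by
    rw [towerHeight_succ]; nlinarith
  have hNh : 7 * towerHeight k ≤ towerReps k * towerHeight k := Nat.mul_le_mul_right _ hN
  obtain ⟨j, hj, hp⟩ := hS.cover (-L)
  rw [Finset.mem_range] at hj
  have ho := hS.occursAt _ hp
  -- The window meets at most two successive blocks. Without a spacer they are matched with copies
  -- `0` and `1`, with a spacer with copies `towerReps k - 1` and `towerReps k`.
  rcases hS.next _ hp with hq | ⟨hsp, hq⟩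
  · have ho' := hS.occursAt _ hq
    refine ⟨L + j, fun i hi => ?_⟩
    rw [abs_le] at hi
    obtain ⟨t, ht⟩ := Int.eq_ofNat_of_zero_le (show 0 ≤ i + (L + j) by omega)
    refine ⟨t, by omega, ht, ?_⟩
    rcases lt_or_ge t (towerHeight k) with h | h
    · have := towerWord_blockPos k 0 h
      rw [blockPos_zero, zero_add] at this
      rw [this, ← ho t h]
      congr 1; omega
    · obtain ⟨u, rfl⟩ := Nat.exists_eq_add_of_le h
      have hu : u < towerHeight k := by omega
      have := towerWord_blockPos k 1 hu
      rw [blockPos_of_lt (by omega), one_mul] at this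
      rw [this, ← ho' u hu]
      congr 1; push_cast at ht; omega
  · have ho' := hS.occursAt _ hq
    obtain ⟨N, hNe⟩ : ∃ N, towerReps k = N + 1 := ⟨towerReps k - 1, by omega⟩
    have hb : blockPos k N = N * towerHeight k := blockPos_of_lt (by omega)
    have hb' : blockPos k (N + 1) = blockPos k N + towerHeight k + 1 :=
      blockPos_succ_of_ge (by omega)
    have hH' : blockPos k N + 2 * towerHeight k ≤ towerHeight (k + 1) := by
      rw [hNe] at hH; rw [hb]; linarith
    refine ⟨blockPos k N + L + j, fun i hi => ?_⟩
    rw [abs_le] at hi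
    obtain ⟨t, ht⟩ := Int.eq_ofNat_of_zero_le (show 0 ≤ i + (L + j) by omega)
    refine ⟨blockPos k N + t, by omega, by push_cast; linarith, ?_⟩
    rcases lt_trichotomy t (towerHeight k) with h | h | h
    · rw [towerWord_blockPos k N h, ← ho t h]
      congr 1; omega
    · rw [h, towerWord_spacer (by omega), ← hsp]
      congr 1; omega
    · obtain ⟨u, rfl⟩ := Nat.exists_eq_add_of_le h
      have hu : u < towerHeight k := by omega
      have := towerWord_blockPos k (N + 1) hu
      rw [hb'] at this
      rw [show blockPos k N + ((towerHeight k).succ + u) = blockPos k N + towerHeight k + 1 + u by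
        omega, this, ← ho' u hu]
      congr 1; push_cast at ht; omega

/-- Every window of a point recurs in every other point at a positive multiple of `m`. -/
theorem exists_mul_shift_agree {x z : ℤ → Bool} (hx : x ∈ towerSubshift) (hz : z ∈ towerSubshift)
    {m : ℕ} (hm : 0 < m) (L : ℕ) : ∃ c : ℕ, ∀ i : ℤ, |i| ≤ L → x (i + (m * c : ℕ)) = z i := by
  set k := 2 * L + m + 1 with hk
  obtain ⟨a, ha⟩ := exists_window_eq_towerWord hz (L := L) (k := k) (by omega)
  obtain ⟨S, hS⟩ := mem_iInter.1 hx (k + 2)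
  -- Starting this far to the right makes the final shift non-negative.
  obtain ⟨j, hj, hp⟩ := hS.cover (|a| + towerHeight (k + 2))
  rw [Finset.mem_range] at hj
  set p := |a| + (towerHeight (k + 2) : ℤ) - (j : ℕ) with hpdef
  have hpa : 0 ≤ p + a := by have := neg_abs_le a; omega
  have hm' : (0 : ℤ) < m := by exact_mod_cast hm
  -- Since `m` divides the length of the inner blocks, passing `e` spacers corrects the residue of
  -- `p + a`.
  obtain ⟨e, he⟩ := Int.eq_ofNat_of_zero_le (Int.emod_nonneg (-(p + a)) hm'.ne')
  have helt : e < m := by have := Int.emod_lt_of_pos (-(p + a)) hm'; omega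
  have hlt := lt_towerHeight (k + 1)
  have h1 := towerReps_pos (k + 1)
  have hocc := (hS.occursAt p hp).inner (i := towerReps (k + 1) - 1 + e) (by omega)
  obtain ⟨c, hc⟩ : (m : ℤ) ∣ p + a + blockPos (k + 1) (towerReps (k + 1) - 1 + e) := by
    rw [blockPos_add]
    obtain ⟨w, hw⟩ := dvd_towerHeight hm (show m ≤ k + 1 + 1 by omega)
    have hdm := Int.emod_add_mul_ediv (-(p + a)) m
    rw [he] at hdm
    refine ⟨(towerReps (k + 1) - 1 + e : ℕ) * w - (-(p + a)) / m, ?_⟩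
    rw [hw]; push_cast; linarith
  have hc0 : 0 ≤ c := by
    by_contra hneg
    push Not at hneg
    have := mul_neg_of_pos_of_neg hm' hneg
    omega
  obtain ⟨c, rfl⟩ := Int.eq_ofNat_of_zero_le hc0
  refine ⟨c, fun i hi => ?_⟩
  obtain ⟨t, ht, hit, hzt⟩ := ha i hi
  rw [hzt, ← hocc t ht]
  congr 1
  push_cast
  linarith

theorem isTotallyMinimal_towerShift :
    IsTotallyMinimal (towerShift 1 : towerSubshift → towerSubshift) := by
  intro m hm K hK ⟨x, hx⟩ hmap
  refine eq_univ_of_forall fun z => ?_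
  rw [← hK.closure_eq]
  have hagree := fun L => exists_mul_shift_agree x.2 z.2 hm L
  choose c hc using hagree
  refine mem_closure_of_tendsto (f := fun L : ℕ => towerShift (m * c L : ℕ) x) (b := atTop) ?_
    (Eventually.of_forall fun L => ?_)
  · refine tendsto_subtype_rng.2 (tendsto_pi_nhds.2 fun i => ?_)
    refine tendsto_const_nhds.congr' ?_
    filter_upwards [eventually_ge_atTop i.natAbs] with L hL
    exact (hc L i (by rw [Int.abs_eq_natAbs]; exact_mod_cast hL)).symm
  · have : (towerShift (m * c L : ℕ) : towerSubshift → towerSubshift) =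
        ((towerShift 1)^[m])^[c L] := by
      rw [← Function.iterate_mul, towerShift_one_iterate]
    rw [this]
    exact hmap.iterate _ hx

theorem towerSubshift_nontrivial : Nontrivial towerSubshift := by
  obtain ⟨x, hx⟩ := towerSubshift_nonempty
  have hpos := towerHeight_pos 1
  obtain ⟨S, hS⟩ := mem_iInter.1 hx 1
  obtain ⟨j, -, hp⟩ := hS.cover 0
  have h0 := hS.occursAt _ hp 0 hpos
  have h1 := towerReps_pos 0
  have hN : blockPos 0 (towerReps 0 - 1) + towerHeight 0 < towerHeight 1 := by decide
  have h2 := hS.occursAt _ hp _ hN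
  rw [towerWord_spacer (by omega)] at h2
  have h3 : towerWord 1 0 = false := by decide
  rw [h3] at h0
  refine ⟨towerShift (0 - (j : ℕ) + (0 : ℕ)) ⟨x, hx⟩,
    towerShift (0 - (j : ℕ) + (blockPos 0 (towerReps 0 - 1) + towerHeight 0 : ℕ)) ⟨x, hx⟩,
    fun h => ?_⟩
  have := congrFun (congrArg Subtype.val h) 0
  rw [towerShift_apply, towerShift_apply, zero_add, zero_add] at this
  exact absurd (h0.symm.trans (this.trans h2)) (by decide)

theorem exists_nontrivial_isPOD : ∃ (X : Type) (_ : MetricSpace X) (_ : CompactSpace X)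
    (T : X ≃ₜ X), IsPOD T ∧ Nontrivial X := by
  refine ⟨towerSubshift, TopologicalSpace.metrizableSpaceMetric towerSubshift, inferInstance,
    towerShift 1, ⟨isTotallyMinimal_towerShift, fun x y hxy => ?_⟩, towerSubshift_nontrivial⟩
  let _ := TopologicalSpace.metrizableSpaceMetric towerSubshift
  obtain ⟨n, hn, h⟩ := exists_shift_agree x.2 y.2 (fun h => hxy (Subtype.ext h))
  refine ⟨n, hn, fun ε hε => ?_⟩
  obtain ⟨L, hL⟩ := exists_forall_dist_lt_of_agree (fun q : towerSubshift × towerSubshift =>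
    dist q.1 q.2) continuous_dist (fun x => dist_self x) hε
  obtain ⟨m, hm⟩ := h L
  refine ⟨m, hL _ _ fun i hi => ?_⟩
  rw [towerShift_one_zpow, towerShift_one_zpow, towerShift_apply, towerShift_apply,
    towerShift_apply]
  exact hm i hi

theorem mainTheorem10 :
    (∀ (X : Type*) [MetricSpace X] [CompactSpace X] (T : X ≃ₜ X), IsPOD T →
      (∀ r s : ℕ, 0 < r → 0 < s → r ≠ s → Prox T r s = univ) ∧
      (Nontrivial X → {x : X | IsMinimalPoint T x}.Nontrivial)) ∧
    (∃ (X : Type) (_ : MetricSpace X) (_ : CompactSpace X) (T : X ≃ₜ X),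
      IsPOD T ∧ {x : X | IsMinimalPoint T x}.Nontrivial ∧
      ∀ r s : ℕ, 0 < r → 0 < s → r ≠ s → Prox T r s = univ) := by
  refine ⟨fun X _ _ T hT => ⟨fun r s hr hs hne => hT.prox_eq_univ hr hs hne,
    hT.nontrivial_minimalPoints⟩, ?_⟩
  obtain ⟨X, hm, hc, T, hT, hX⟩ := exists_nontrivial_isPOD
  exact ⟨X, hm, hc, T, hT, hT.nontrivial_minimalPoints hX,
    fun r s hr hs hne => hT.prox_eq_univ hr hs hne⟩
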